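/- Let $n,m\ge 1$ and $0\le k<\min(n,m)$ be integers, and let $D=n^m\setminus\delta_k$ be the diagram obtained from the rectangle with $m$ rows of length $n$ by removing the last $k+1-i$ boxes of row $i$ for $1\le i\le k$. A plane partition of shape $D$ is a filling $T$ of the boxes of $D$ with nonnegative integers that weakly decrease along rows and down columns; its volume is $|T|=\sum_{(i,j)\in D}T[i,j]$, and its rightmost diagonal is $(T[1,n-k],T[2,n-k+1],\dots,T[k+1,n])$. Let $\mu=(\mu_1\ge\mu_2\ge\dots\ge\mu_{k+1}\ge 0)$ be a partition, put $\mu_i=0$ for $i>k+1$ and $|\mu|=\sum_i\mu_i$, and let $0<q<1$. Then $\sum_{T:\,\mathrm{sh}(T)=D}q^{|T|}$ converges, the determinant below is nonzero, and the $q^{\mathrm{vol}}$ distribution of the rightmost diagonal is $$\frac{\displaystyle\sum_{T:\ \mathrm{sh}(T)=D,\ \text{rightmost diagonal }=\mu}q^{|T|}}{\displaystyle\sum_{T:\ \mathrm{sh}(T)=D}q^{|T|}}=\frac{\displaystyle q^{|\mu|(n-k)}\prod_{i=1}^{m}\bigl(1-q^{n-k+i-1}\bigr)\prod_{1\le i<j\le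 m}q^{n-k}\bigl(q^{\mu_j+m-j}-q^{\mu_i+m-i}\bigr)\bigl(1-q^{2n-2k+i+j-2}\bigr)}{\displaystyle\det\Bigl[q^{(n-k+i-1)(m-j)}-(-1)^{k+1}\chi(j>k+1)\,q^{(n-k+i-1)(m-k+j-2)}\Bigr]_{i,j=1}^{m}},$$ where $\chi(j>k+1)$ is $1$ if $j>k+1$ and $0$ otherwise. -/

import Mathlib

/-- The straight diagram of the rectangle `n^m` (`m` rows of length `n`) truncated by the staircase
`δ_k = (k, k-1, …, 1)`: boxes are removed at the right ends of the rows, so that, with rows and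
columns counted from `0`, row `i` consists of its first `n - (k - i)` boxes (truncated subtraction:
`k - i = 0` for `i ≥ k`). -/
def truncatedRectangle (n m k : ℕ) : Finset (ℕ × ℕ) :=
  (Finset.range m ×ˢ Finset.range n).filter fun b => b.2 < n - (k - b.1)

/-- A plane partition of shape `D`: a filling of the boxes of `D` with nonnegative integers that
weakly decrease along rows and down columns. The value outside `D` is `0` by convention. -/
@[ext]
structure PlanePartition (D : Finset (ℕ × ℕ)) where
  entry : ℕ → ℕ → ℕ
  row_weak : ∀ i j₁ j₂, j₁ ≤ j₂ → (i, j₁) ∈ D → (i, j₂) ∈ D → entry i j₂ ≤ entry i j₁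
  col_weak : ∀ i₁ i₂ j, i₁ ≤ i₂ → (i₁, j) ∈ D → (i₂, j) ∈ D → entry i₂ j ≤ entry i₁ j
  zeros : ∀ i j, (i, j) ∉ D → entry i j = 0

/-- The volume of a plane partition: the sum of its entries. -/
def PlanePartition.volume {D : Finset (ℕ × ℕ)} (T : PlanePartition D) : ℕ :=
  ∑ b ∈ D, T.entry b.1 b.2

/-- The rightmost diagonal of a plane partition of shape `n^m ∖ δ_k`, from top to bottom, is
`(μ 0, …, μ k)`. In coordinates counted from `1` it is `(T[1,n-k], T[2,n-k+1], …, T[k+1,n])`. -/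
def PlanePartition.HasRightmostDiagonal {n m k : ℕ}
    (T : PlanePartition (truncatedRectangle n m k)) (μ : ℕ → ℕ) : Prop :=
  ∀ r, r ≤ k → T.entry r (n - k - 1 + r) = μ r

/-- The value at `μ` of the volume distribution of the rightmost diagonal: the proportion of the
plane partitions of shape `n^m ∖ δ_k` with rightmost diagonal `μ`, when each plane partition `T`
has weight `q ^ vol(T)`. -/
noncomputable def diagonalDistribution (n m k : ℕ) (q : ℝ) (μ : ℕ → ℕ) : ℝ :=
  (∑' T : {T : PlanePartition (truncatedRectangle n m k) // T.HasRightmostDiagonal μ},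
      q ^ T.1.volume) /
    ∑' T : PlanePartition (truncatedRectangle n m k), q ^ T.volume

/-- The `m × m` matrix
`[x_i^(m-j) - (-1)^(k+1) χ(j > k+1) x_i^(m-k+j-2)]`, `1 ≤ i, j ≤ m`, at `x_i = q^(n-k+i-1)`;
here the indices are counted from `0`. -/
def kingMatrix (n m k : ℕ) (q : ℝ) : Matrix (Fin m) (Fin m) ℝ :=
  Matrix.of fun i j =>
    q ^ ((n - k + i.1) * (m - 1 - j.1)) -
      (-1) ^ (k + 1) * (if k < j.1 then 1 else 0) * q ^ ((n - k + i.1) * (m - k - 1 + j.1))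

open Finset Matrix

/-! Consecutive diagonals of a plane partition interlace, so the sum over all T with a given
rightmost diagonal is an iterated sum over interlacing sequences. Summing the alternant a_ν' over
the ν' that interlace ν returns, up to a factor independent of ν, the alternant a_ν in the same
variables (Pieri) or with an extra variable 1 (branching); the weight q^|ν| of the new diagonal then
multiplies every variable by q. Hence the sum for μ is C · a_μ(x) with x_i = q^(n-k+i-1) and C
independent of μ (`exists_hasSum_pow_volume`). Padding μ with zeros first turns the truncated
rectangle into a trapezoid (`truncatedRectangleEquiv`).

In the quotient C cancels and a_μ / Σ_ν a_ν remains, with ν running over partitions with at most k+1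
parts. King's identity (`exists_hasSum_alternant`) gives Σ_ν a_ν · ∏(1 - x_i) ∏(1 - x_i x_j) as the
determinant in the denominator. It is proved by induction on the number of variables: both sides
expand along the last column by the same recurrence, once that column is replaced by a product
(`prod_sub_last_col_mem_span`). At powers of q the alternant a_μ is a Vandermonde determinant
(`alternant_pow`), which produces the numerator. -/

/-! ### Column operations on King's determinant -/

/-- The elementary symmetric functions of `x`, with signs, as coefficients of `∏ (z - x l)` and of
`∏ (1 - x l * z)`. -/
theorem exists_coeff_prod_sub {M : ℕ} (x : Fin M → ℝ) :
    ∃ c : ℕ → ℝ, c 0 = 1 ∧ c M = (-1) ^ M * ∏ l, x l ∧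
      (∀ z, ∏ l, (z - x l) = ∑ i ∈ range (M + 1), c i * z ^ (M - i)) ∧
      ∀ z, z ≠ 0 → ∏ l, (1 - x l * z) = ∑ i ∈ range (M + 1), c i * z ^ i := by
  set Q : Polynomial ℝ := ∏ l, (Polynomial.X - Polynomial.C (x l)) with hQ
  have hdeg : Q.natDegree = M := by simp [hQ]
  have hmon : Q.Monic := Polynomial.monic_prod_of_monic _ _ fun i _ => Polynomial.monic_X_sub_C _
  have hev : ∀ z, ∏ l, (z - x l) = ∑ i ∈ range (M + 1), Q.coeff i * z ^ i := fun z => by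
    rw [← Polynomial.eval_eq_sum_range' (by omega : Q.natDegree < M + 1), hQ,
      Polynomial.eval_prod]
    simp
  have hev' : ∀ z, ∏ l, (z - x l) = ∑ i ∈ range (M + 1), Q.coeff (M - i) * z ^ (M - i) := by
    intro z
    rw [hev, ← sum_range_reflect]
    refine sum_congr rfl fun i hi => ?_
    rw [show M + 1 - 1 - i = M - i by omega]
  refine ⟨fun i => Q.coeff (M - i), ?_, ?_, hev', fun z hz => ?_⟩
  · have := hmon.coeff_natDegree
    rw [hdeg] at this
    simpa using this
  · simp only [Nat.sub_self, Polynomial.coeff_zero_eq_eval_zero, hQ, Polynomial.eval_prod]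
    simp [prod_neg]
  · have h1 : ∏ l, (1 - x l * z) = z ^ M * ∏ l, (z⁻¹ - x l) := by
      have : z ^ M = ∏ _l : Fin M, z := by simp
      rw [this, ← prod_mul_distrib]
      refine prod_congr rfl fun l _ => ?_
      field_simp
    rw [h1, hev', mul_sum]
    refine sum_congr rfl fun i hi => ?_
    have hi' : i ≤ M := by simpa [Nat.lt_succ_iff] using hi
    have : z ^ M = z ^ i * z ^ (M - i) := by rw [← pow_add]; congr 1; omega
    rw [this, inv_pow]
    field_simp

theorem det_updateCol_eq_of_sub_mem_span {n : ℕ} (A : Matrix (Fin n) (Fin n) ℝ) (j : Fin n)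
    (v w : Fin n → ℝ)
    (h : v - w ∈ Submodule.span ℝ (Set.range fun k : {k // k ≠ j} => fun i => A i k.1)) :
    (A.updateCol j v).det = (A.updateCol j w).det := by
  have key : ∀ u ∈ Submodule.span ℝ (Set.range fun k : {k // k ≠ j} => fun i => A i k.1),
      (A.updateCol j u).det = 0 := by
    intro u hu
    induction hu using Submodule.span_induction with
    | mem u hu =>
      obtain ⟨k, rfl⟩ := hu
      exact det_updateCol_eq_zero k.2
    | zero => exact det_eq_zero_of_column_eq_zero j (by simp)
    | add u v _ _ hu hv => rw [det_updateCol_add, hu, hv, add_zero]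
    | smul c u _ hu => rw [det_updateCol_smul, hu, mul_zero]
  have h1 : v = w + (v - w) := by abel
  rw [h1, det_updateCol_add, key _ h, add_zero]

/-- The matrix `[x_i^(m-j) - (-1)^p χ(j > p) x_i^(m-p+j-1)]`, with indices counted from `0`. -/
def kingMat (m p : ℕ) (x : Fin m → ℝ) : Matrix (Fin m) (Fin m) ℝ :=
  of fun i j => x i ^ (m - 1 - j.1) -
    (-1) ^ p * (if p ≤ j.1 then 1 else 0) * x i ^ (m - p + j.1)

/-- The alternant `det[x_i^(μ_j + m - j)]`, with indices counted from `0`. -/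
def alternant {m : ℕ} (x : Fin m → ℝ) (μ : Fin m → ℕ) : ℝ :=
  (of fun i j : Fin m => x i ^ (μ j + (m - 1 - j.1))).det

/-- The d_b are the coefficients of (Σ c_b z^b) / (1 + z); this is division by 1 + z with the powers
z^b replaced by arbitrary h_b. -/
theorem sum_range_succ_mul_eq_abel (c d h : ℕ → ℝ) (h0 : d 0 = c 0)
    (hd : ∀ b, d (b + 1) = c (b + 1) - d b) (n : ℕ) :
    ∑ b ∈ range (n + 1), c b * h b = ∑ b ∈ range n, d b * (h b + h (b + 1)) + d n * h n := by
  induction n with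
  | zero => simp [h0]
  | succ n ih => rw [sum_range_succ, ih, sum_range_succ _ n, hd]; ring

/-- Since x_i is a root of ∏(z - x_l), the power x_i^b in the expansion of ∏_l (1 - x_l x_i) may be
replaced by h_b = x_i^b - (-1)^p x_i^(2(m+1)-p-b). The factor l = i is (1 - x_i)(1 + x_i), and
dividing by 1 + x_i turns the h_b into combinations of columns, the last one with coefficient 1. -/
theorem prod_sub_last_col_mem_span {m p : ℕ} (hp : p ≤ m) (x : Fin (m + 1) → ℝ)
    (hx : ∀ i, 0 < x i) :
    ((fun i => (1 - x i) * ∏ l, (1 - x (i.succAbove l) * x i)) -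
      fun i => kingMat (m + 1) p x i (Fin.last m)) ∈
      Submodule.span ℝ (Set.range fun k : {k // k ≠ Fin.last m} =>
        fun i => kingMat (m + 1) p x i k.1) := by
  set S := Submodule.span ℝ (Set.range fun k : {k // k ≠ Fin.last m} =>
        fun i => kingMat (m + 1) p x i k.1) with hS
  have hK : ∀ b, 1 ≤ b → b ≤ m → (fun i => x i ^ b - (-1) ^ p * (if b < m + 1 - p then 1 else 0) *
      x i ^ (2 * m + 1 - p - b)) ∈ S := by
    intro b hb1 hb2
    refine Submodule.subset_span ⟨⟨⟨m - b, by omega⟩, ?_⟩, ?_⟩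
    · simp [Fin.ext_iff]; omega
    · funext i
      simp only [kingMat, of_apply]
      rw [show m + 1 - 1 - (m - b) = b by omega,
        show m + 1 - p + (m - b) = 2 * m + 1 - p - b by omega]
      have : (p ≤ m - b) = (b < m + 1 - p) := by apply propext; omega
      simp only [this]
  -- The columns without a second term are pure powers; the range of exponents m+1-p, …, m is
  -- symmetric under b ↦ 2m+1-p-b.
  have hpow : ∀ b, m + 1 - p ≤ b → b ≤ m → (fun i => x i ^ b) ∈ S := by
    intro b hb1 hb2
    have := hK b (by omega) hb2
    rw [if_neg (by omega)] at this
    simpa using this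
  set g : ℕ → Fin (m + 1) → ℝ := fun b i => x i ^ b - (-1) ^ p * x i ^ (2 * m + 1 - p - b) with hg
  have hgS : ∀ b, 1 ≤ b → b ≤ m → g b ∈ S := by
    intro b hb1 hb2
    by_cases hb : b < m + 1 - p
    · have := hK b hb1 hb2
      rw [if_pos hb] at this
      simpa using this
    · have h1 := hpow b (by omega) hb2
      have h2 := hpow (2 * m + 1 - p - b) (by omega) (by omega)
      exact S.sub_mem h1 (S.smul_mem ((-1) ^ p) h2)
  -- This is the boundary term h_(m+1) / (1 + x_i) of the Abel summation; the quotient is a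
  -- geometric sum in the pure powers.
  have huS : (fun i => (x i ^ (m + 1) - (-1) ^ p * x i ^ (m + 1 - p)) / (1 + x i)) ∈ S := by
    have h1 : (∑ t ∈ range p, ((-1 : ℝ) ^ (p - 1 - t)) • fun i => x i ^ (m + 1 - p + t)) ∈ S := by
      refine S.sum_mem fun t ht => S.smul_mem _ (hpow _ (by omega) ?_)
      have := mem_range.1 ht
      omega
    convert h1 using 1
    funext i
    have h2 := geom_sum₂_mul (x i) (-1) p
    have h3 : 1 + x i ≠ 0 := by have := hx i; positivity
    rw [div_eq_iff h3]
    have h4 : x i ^ (m + 1) = x i ^ (m + 1 - p) * x i ^ p := by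
      rw [← pow_add]; congr 1; omega
    rw [h4, mul_comm ((-1 : ℝ) ^ p), ← mul_sub, ← h2]
    simp only [Finset.sum_apply, Pi.smul_apply, smul_eq_mul, sum_mul, mul_sum]
    refine sum_congr rfl fun t _ => ?_
    rw [pow_add]
    ring
  obtain ⟨c, hc0, -, hcz, hce⟩ := exists_coeff_prod_sub x
  set d : ℕ → ℝ := fun b => Nat.rec (c 0) (fun n dn => c (n + 1) - dn) b with hd
  have hd0 : d 0 = c 0 := rfl
  have hds : ∀ b, d (b + 1) = c (b + 1) - d b := fun b => rfl
  have hw : ((fun i => (1 - x i) * ∏ l, (1 - x (i.succAbove l) * x i)) -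
      fun i => kingMat (m + 1) p x i (Fin.last m)) =
      ∑ b ∈ range m, d (b + 1) • g (b + 1) +
        d (m + 1) • fun i => (x i ^ (m + 1) - (-1) ^ p * x i ^ (m + 1 - p)) / (1 + x i) := by
    funext i
    have hlast : kingMat (m + 1) p x i (Fin.last m) = g 0 i := by
      simp only [kingMat, of_apply, Fin.val_last, hp, if_true, hg]
      rw [show m + 1 - p + m = 2 * m + 1 - p - 0 by omega]
      simp
    have hx0 := hx i
    have h3 : 1 + x i ≠ 0 := by positivity
    set h : ℕ → ℝ := fun b => x i ^ b - (-1) ^ p * x i ^ (2 * (m + 1) - p - b) with hh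
    have hgh : ∀ b, b ≤ m → (1 + x i) * g b i = h b + h (b + 1) := by
      intro b hb
      simp only [hg, hh]
      rw [show 2 * (m + 1) - p - b = (2 * m + 1 - p - b) + 1 by omega,
        show 2 * (m + 1) - p - (b + 1) = 2 * m + 1 - p - b by omega]
      ring
    have hA := sum_range_succ_mul_eq_abel c d h hd0 hds (m + 1)
    have hB : ∑ b ∈ range (m + 1 + 1), c b * h b = ∏ l, (1 - x l * x i) := by
      have hz : ∏ l, (x i - x l) = 0 := prod_eq_zero (mem_univ i) (sub_self _)
      have h1 : ∑ b ∈ range (m + 1 + 1), c b * h b = ∏ l, (1 - x l * x i) -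
          (-1) ^ p * x i ^ (m + 1 - p) * ∏ l, (x i - x l) := by
        rw [hce _ hx0.ne', hcz, mul_sum, ← sum_sub_distrib]
        refine sum_congr rfl fun b hb => ?_
        have hb' := mem_range.1 hb
        simp only [hh]
        rw [show 2 * (m + 1) - p - b = (m + 1 - p) + (m + 1 - b) by omega, pow_add]
        ring
      rw [h1, hz]; ring
    rw [hB, Fin.prod_univ_succAbove _ i] at hA
    have hC : ∑ b ∈ range (m + 1), d b * (h b + h (b + 1)) =
        (1 + x i) * ∑ b ∈ range (m + 1), d b * g b i := by
      rw [mul_sum]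
      refine sum_congr rfl fun b hb => ?_
      rw [← hgh b (by have := mem_range.1 hb; omega)]
      ring
    rw [hC, sum_range_succ'] at hA
    simp only [Pi.sub_apply, Pi.add_apply, Finset.sum_apply, Pi.smul_apply, smul_eq_mul, hlast]
    have hD : h (m + 1) = x i ^ (m + 1) - (-1) ^ p * x i ^ (m + 1 - p) := by
      simp only [hh]
      rw [show 2 * (m + 1) - p - (m + 1) = m + 1 - p by omega]
    rw [← hD]
    rw [hd0, hc0] at hA
    generalize ∏ l, (1 - x (i.succAbove l) * x i) = W at hA ⊢
    field_simp
    linear_combination hA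
  rw [hw]
  refine S.add_mem (S.sum_mem fun b hb => S.smul_mem _ (hgS _ (by omega) ?_)) (S.smul_mem _ huS)
  have := mem_range.1 hb
  omega

/-- Laplace expansion along the replaced last column; in each minor every row has a common factor
x_l, which leaves the same matrix in one variable fewer. -/
theorem det_kingMat_succ {m p : ℕ} (hp : p ≤ m) (x : Fin (m + 1) → ℝ) (hx : ∀ i, 0 < x i) :
    (kingMat (m + 1) p x).det = ∑ t : Fin (m + 1), (-1) ^ (t.1 + m) *
      ((1 - x t) * ∏ l, (1 - x (t.succAbove l) * x t)) *
      ((∏ l, x (t.succAbove l)) * (kingMat m p (x ∘ t.succAbove)).det) := by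
  have h1 := det_updateCol_eq_of_sub_mem_span _ _ _ _ (prod_sub_last_col_mem_span hp x hx)
  rw [updateCol_eq_self] at h1
  rw [← h1, det_succ_column _ (Fin.last m)]
  refine sum_congr rfl fun t _ => ?_
  rw [updateCol_self, Fin.val_last]
  congr 1
  rw [← det_mul_column]
  congr 1
  ext i j
  have hj : (Fin.last m).succAbove j ≠ Fin.last m := Fin.succAbove_ne _ _
  rw [submatrix_apply, updateCol_ne hj]
  simp only [kingMat, of_apply, Fin.succAbove_last, Fin.val_castSucc, Function.comp_apply]
  have hj' := j.2
  rw [show m + 1 - 1 - j.1 = (m - 1 - j.1) + 1 by omega,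
    show m + 1 - p + j.1 = (m - p + j.1) + 1 by omega]
  ring

/-- Only the last columns differ. As x_i is a root of ∏(z - x_l), the power x_i^(m+1) reduces modulo
the other columns to the constant (-1)^m ∏ x_l. -/
theorem det_kingMat_self_pred {m : ℕ} (x : Fin (m + 1) → ℝ) :
    (kingMat (m + 1) m x).det = (1 - ∏ l, x l) * (kingMat (m + 1) (m + 1) x).det := by
  obtain ⟨c, hc0, hcM, hcz, -⟩ := exists_coeff_prod_sub x
  set A := kingMat (m + 1) (m + 1) x with hA
  have hAe : ∀ i j, A i j = x i ^ (m - j.1) := by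
    intro i j
    simp only [hA, kingMat, of_apply]
    rw [if_neg (by omega)]
    simp
  have h1 : kingMat (m + 1) m x =
      A.updateCol (Fin.last m) (fun i => 1 - (-1) ^ m * x i ^ (m + 1)) := by
    ext i j
    by_cases hj : j = Fin.last m
    · subst hj
      rw [updateCol_self]
      simp only [kingMat, of_apply, Fin.val_last]
      rw [show m + 1 - m + m = m + 1 by omega]
      simp
    · rw [updateCol_ne hj, hAe]
      have : j.1 < m := by
        have h2 : j.1 ≠ m := fun h => hj (Fin.ext h)
        omega
      simp only [kingMat, of_apply]
      rw [if_neg (by omega)]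
      simp
  have h2 : (1 - ∏ l, x l) * A.det =
      (A.updateCol (Fin.last m) ((1 - ∏ l, x l) • fun i => A i (Fin.last m))).det := by
    rw [det_updateCol_smul, updateCol_eq_self]
  rw [h2, h1]
  refine det_updateCol_eq_of_sub_mem_span _ _ _ _ ?_
  have h3 : ((fun i => 1 - (-1) ^ m * x i ^ (m + 1)) -
      (1 - ∏ l, x l) • fun i => A i (Fin.last m)) =
      ∑ j : Fin m, ((-1) ^ m * c (j.1 + 1)) • fun i => A i j.castSucc := by
    funext i
    have hz : ∏ l, (x i - x l) = 0 := prod_eq_zero (mem_univ i) (sub_self _)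
    rw [hcz, sum_range_succ, sum_range_succ', hc0, hcM, sum_range] at hz
    simp only [Pi.sub_apply, Finset.sum_apply, Pi.smul_apply, smul_eq_mul, hAe, Fin.val_last,
      Fin.val_castSucc, mul_assoc, ← mul_sum]
    simp only [Nat.add_sub_add_right] at hz
    have h4 : ((-1 : ℝ) ^ m) * (-1) ^ m = 1 := by rw [← mul_pow]; simp
    simp only [Nat.sub_self, pow_zero, Nat.sub_zero] at hz ⊢
    rw [pow_succ (-1 : ℝ)] at hz
    linear_combination (-(-1 : ℝ) ^ m) * hz - (∏ l, x l) * h4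
  rw [h3]
  refine Submodule.sum_mem _ fun j _ => Submodule.smul_mem _ _ (Submodule.subset_span
    ⟨⟨j.castSucc, (Fin.castSucc_lt_last j).ne⟩, rfl⟩)

/-! ### King's identity for partitions with a bounded number of parts -/

/-- The product `∏ (1 - x_i) ∏_{i<j} (1 - x_i x_j)`. -/
def littlewoodProd {m : ℕ} (x : Fin m → ℝ) : ℝ :=
  (∏ i, (1 - x i)) * ∏ j, ∏ i, if i < j then 1 - x i * x j else 1

theorem littlewoodProd_succAbove {m : ℕ} (x : Fin (m + 1) → ℝ) (t : Fin (m + 1)) :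
    littlewoodProd x = ((1 - x t) * ∏ l, (1 - x (t.succAbove l) * x t)) *
      littlewoodProd (x ∘ t.succAbove) := by
  unfold littlewoodProd
  have h1 : (∏ j, ∏ i, if i < j then 1 - x i * x j else 1) =
      (∏ l, (1 - x (t.succAbove l) * x t)) * ∏ j, ∏ i,
        if i < j then 1 - (x ∘ t.succAbove) i * (x ∘ t.succAbove) j else 1 := by
    rw [Fin.prod_univ_succAbove _ t, Fin.prod_univ_succAbove _ t, if_neg (lt_irrefl _), one_mul]
    simp_rw [Fin.prod_univ_succAbove (fun i => if i < _ then 1 - x i * _ else 1) t]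
    rw [prod_mul_distrib, ← mul_assoc, ← prod_mul_distrib]
    congr 1
    · refine prod_congr rfl fun l _ => ?_
      rcases lt_or_gt_of_ne (Fin.succAbove_ne t l) with h | h
      · rw [if_pos h, if_neg h.not_gt, mul_one]
      · rw [if_neg h.not_gt, if_pos h, one_mul, mul_comm (x t)]
    · simp [(Fin.strictMono_succAbove t).lt_iff_lt]
  rw [h1, Fin.prod_univ_succAbove _ t]
  simp only [Function.comp_apply]
  ring

theorem HasSum.mul_real {α β : Type*} {f : α → ℝ} {g : β → ℝ} {s t : ℝ} (hf : HasSum f s)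
    (hg : HasSum g t) : HasSum (fun a : α × β => f a.1 * g a.2) (s * t) :=
  hf.mul hg (summable_mul_of_summable_norm hf.summable.norm hg.summable.norm)

/-- Partitions with at most `p` parts. -/
abbrev BoundedPartition (p : ℕ) : Type := {μ : ℕ → ℕ // Antitone μ ∧ ∀ i, p ≤ i → μ i = 0}

theorem alternant_add_const {m : ℕ} (x : Fin m → ℝ) (μ ν : Fin m → ℕ) (t : ℕ)
    (h : ∀ i, ν i = μ i + t) :
    alternant x ν = (∏ i, x i) ^ t * alternant x μ := by
  rw [alternant, alternant, ← prod_pow, ← det_mul_column]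
  congr 1
  ext i j
  simp only [of_apply]
  rw [h, ← pow_add]
  congr 1
  omega

/-- When the last part is 0 the last column is constantly 1, so Laplace expansion gives the
counterpart of `det_kingMat_succ`. -/
theorem alternant_succ {m : ℕ} (x : Fin (m + 1) → ℝ) (μ : ℕ → ℕ) (h : μ m = 0) :
    alternant x (fun j => μ j) = ∑ t : Fin (m + 1), (-1) ^ (t.1 + m) *
      ((∏ l, x (t.succAbove l)) * alternant (x ∘ t.succAbove) fun j => μ j) := by
  rw [alternant, det_succ_column _ (Fin.last m)]
  refine sum_congr rfl fun t _ => ?_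
  rw [Fin.val_last, of_apply, Fin.val_last, h]
  simp only [add_tsub_cancel_right, tsub_self, add_zero, pow_zero, mul_one]
  congr 1
  rw [alternant, ← det_mul_column]
  congr 1
  ext i j
  simp only [submatrix_apply, of_apply, Fin.succAbove_last, Fin.val_castSucc, Function.comp_apply]
  have hj' := j.2
  rw [show m - j.1 = (m - 1 - j.1) + 1 by omega]
  ring

/-- A partition with at most `m + 1` parts is a partition with at most `m` parts plus a constant
on the first `m + 1` indices. -/
def boundedPartitionSuccEquiv (m : ℕ) : BoundedPartition m × ℕ ≃ BoundedPartition (m + 1) where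
  toFun a := ⟨fun i => if i ≤ m then a.1.1 i + a.2 else 0, by
    constructor
    · intro i j hij
      have := a.1.2.1 hij
      dsimp only
      split_ifs <;> omega
    · intro i hi
      exact if_neg (by omega)⟩
  invFun ν := (⟨fun i => ν.1 i - ν.1 m, by
    constructor
    · intro i j hij
      exact Nat.sub_le_sub_right (ν.2.1 hij) _
    · intro i hi
      exact Nat.sub_eq_zero_of_le (ν.2.1 hi)⟩, ν.1 m)
  left_inv a := by
    have hm := a.1.2.2 m le_rfl
    refine Prod.ext (Subtype.ext (funext fun i => ?_)) ?_
    · dsimp only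
      simp only [le_refl, if_true, hm]
      split_ifs with h
      · omega
      · rw [a.1.2.2 i (by omega)]; omega
    · simp [hm]
  right_inv ν := by
    refine Subtype.ext (funext fun i => ?_)
    dsimp only
    split_ifs with h
    · have := ν.2.1 h
      omega
    · rw [ν.2.2 i (by omega)]

/-- **King's identity** for the sum of the Schur functions of partitions with at most `p` parts,
multiplied by the Vandermonde determinant. -/
theorem exists_hasSum_alternant (m : ℕ) : ∀ p, p ≤ m → ∀ x : Fin m → ℝ,
    (∀ i, 0 < x i) → (∀ i, x i < 1) →
    ∃ F, HasSum (fun μ : BoundedPartition p => (alternant x fun j => μ.1 j)) F ∧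
      F * littlewoodProd x = (kingMat m p x).det := by
  induction m with
  | zero =>
    intro p hp x _ _
    obtain rfl : p = 0 := by omega
    have : Unique (BoundedPartition 0) :=
      { default := ⟨fun _ => 0, fun _ _ _ => le_rfl, fun _ _ => rfl⟩
        uniq := fun a => Subtype.ext (funext fun i => a.2.2 i (Nat.zero_le i)) }
    refine ⟨_, hasSum_unique _, ?_⟩
    simp [alternant, littlewoodProd]
  | succ m ih =>
    -- For p ≤ m the two expansions agree term by term; `littlewoodProd_succAbove` supplies the
    -- factor by which they differ.
    have main : ∀ p, p ≤ m → ∀ x : Fin (m + 1) → ℝ,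
        (∀ i, 0 < x i) → (∀ i, x i < 1) →
        ∃ F, HasSum (fun μ : BoundedPartition p => (alternant x fun j => μ.1 j)) F ∧
          F * littlewoodProd x = (kingMat (m + 1) p x).det := by
      intro p hp x hx0 hx1
      choose F hF hFP using fun t : Fin (m + 1) => ih p hp (x ∘ t.succAbove)
        (fun i => hx0 _) (fun i => hx1 _)
      refine ⟨∑ t : Fin (m + 1), (-1) ^ (t.1 + m) * ((∏ l, x (t.succAbove l)) * F t), ?_, ?_⟩
      · simp_rw [fun μ : BoundedPartition p => alternant_succ x μ.1 (μ.2.2 m hp)]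
        exact hasSum_sum fun t _ => ((hF t).mul_left _).mul_left _
      · rw [det_kingMat_succ hp x hx0, sum_mul]
        refine sum_congr rfl fun t _ => ?_
        rw [← hFP, littlewoodProd_succAbove x t]
        ring
    intro p hp x hx0 hx1
    rcases Nat.lt_or_ge p (m + 1) with hp' | hp'
    · exact main p (by omega) x hx0 hx1
    obtain rfl : p = m + 1 := by omega
    obtain ⟨F, hF, hFP⟩ := main m le_rfl x hx0 hx1
    have hpos : 0 < ∏ l, x l := prod_pos fun i _ => hx0 i
    have hlt : ∏ l, x l < 1 := by
      have := prod_lt_prod_of_nonempty (fun i _ => hx0 i) (fun i _ => hx1 i)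
        (univ_nonempty (α := Fin (m + 1)))
      simpa using this
    have hne : 1 - ∏ l, x l ≠ 0 := by linarith
    refine ⟨F * (1 - ∏ l, x l)⁻¹, ?_, ?_⟩
    -- For p = m+1, splitting off the smallest part t multiplies the alternant by (∏ x_l)^t, whence
    -- a geometric series.
    · have hg := hasSum_geometric_of_lt_one hpos.le hlt
      have hmul : HasSum (fun a : BoundedPartition m × ℕ =>
          (alternant x fun j => a.1.1 j) * (∏ l, x l) ^ a.2) (F * (1 - ∏ l, x l)⁻¹) :=
        HasSum.mul_real (f := fun μ : BoundedPartition m => (alternant x fun j => μ.1 j)) hF hg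
      rw [← (boundedPartitionSuccEquiv m).hasSum_iff]
      have hfun : (fun μ : BoundedPartition (m + 1) => (alternant x fun j => μ.1 j)) ∘
          boundedPartitionSuccEquiv m = fun a : BoundedPartition m × ℕ =>
          (alternant x fun j => a.1.1 j) * (∏ l, x l) ^ a.2 := by
        funext a
        rw [mul_comm]
        exact alternant_add_const _ _ _ _ fun i => if_pos (Nat.lt_succ_iff.1 i.2)
      rw [hfun]
      exact hmul
    · rw [det_kingMat_self_pred] at hFP
      rw [mul_right_comm, hFP]
      field_simp

/-! ### Sums of alternants over interlacing sequences -/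

theorem hasSum_pi_prod {m : ℕ} (g : Fin m → ℕ → ℝ) (s : Fin m → ℝ)
    (hg : ∀ i, HasSum (g i) (s i)) :
    HasSum (fun f : Fin m → ℕ => ∏ i, g i (f i)) (∏ i, s i) := by
  induction m with
  | zero => simp
  | succ m ih =>
    rw [← (Fin.consEquiv fun _ => ℕ).hasSum_iff, Fin.prod_univ_succ]
    have h := ih (fun i => g i.succ) (fun i => s i.succ) fun i => hg i.succ
    refine ((hg 0).mul_real h).congr_fun fun a => ?_
    simp [Fin.consEquiv, Fin.prod_univ_succ]

/-- The variable f j occurs in column j only, so summation can be carried out column by column. -/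
theorem hasSum_det {m : ℕ} (g : Fin m → Fin m → ℕ → ℝ) (s : Fin m → Fin m → ℝ)
    (hg : ∀ i j, HasSum (g i j) (s i j)) :
    HasSum (fun f : Fin m → ℕ => (of fun i j => g i j (f j)).det) (of s).det := by
  simp only [det_apply, of_apply]
  exact hasSum_sum fun σ _ => (hasSum_pi_prod _ _ fun i => hg (σ i) i).const_smul _

theorem hasSum_ite_le_pow {x : ℝ} (h0 : 0 ≤ x) (h1 : x < 1) (a d : ℕ) :
    HasSum (fun l => if a ≤ l then x ^ (l + d) else 0) (x ^ (a + d) / (1 - x)) := by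
  have h := (hasSum_geometric_of_lt_one h0 h1).mul_left (x ^ (a + d))
  rw [← div_eq_mul_inv] at h
  have hinj : Function.Injective fun l : ℕ => a + l := fun _ _ h => Nat.add_left_cancel h
  rw [← hinj.hasSum_iff]
  · refine h.congr_fun fun l => ?_
    simp only [Function.comp_apply, Nat.le_add_right, if_true]
    ring
  · intro l hl
    rw [if_neg]
    intro hal
    exact hl ⟨l - a, by dsimp only; omega⟩

theorem hasSum_ite_le_le_pow {x : ℝ} (h0 : 0 ≤ x) (h1 : x < 1) {a b : ℕ} (d : ℕ) (hab : a ≤ b) :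
    HasSum (fun l => if a ≤ l ∧ l ≤ b then x ^ (l + d) else 0)
      ((x ^ (a + d) - x ^ (b + (d + 1))) / (1 - x)) := by
  have h := (hasSum_ite_le_pow h0 h1 a d).sub (hasSum_ite_le_pow h0 h1 (b + 1) d)
  rw [← sub_div, show b + 1 + d = b + (d + 1) by ring] at h
  refine h.congr_fun fun l => ?_
  by_cases h2 : a ≤ l <;> by_cases h3 : l ≤ b
  · rw [if_pos ⟨h2, h3⟩, if_pos h2, if_neg (by omega), sub_zero]
  · rw [if_neg (by tauto), if_pos h2, if_pos (by omega), sub_self]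
  · rw [if_neg (by tauto), if_neg h2, if_neg (by omega), sub_zero]
  · omega

/-- A violated condition makes its column zero. Interlacing conditions thus become conditions on
separate columns, as `hasSum_det` requires. -/
theorem det_ite_forall_eq_indicator {m : ℕ} (x : Fin m → ℝ) (d : Fin m → ℕ)
    (P : Fin m → ℕ → Prop) [∀ j l, Decidable (P j l)] (f : Fin m → ℕ) :
    (of fun i j => if P j (f j) then x i ^ (f j + d j) else 0).det =
      Set.indicator {f | ∀ j, P j (f j)}
        (fun f : Fin m → ℕ => (of fun i j => x i ^ (f j + d j)).det) f := by
  by_cases h : ∀ j, P j (f j)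
  · rw [Set.indicator_of_mem (by exact h)]
    simp [h]
  · rw [Set.indicator_of_notMem (by exact h)]
    push Not at h
    obtain ⟨j, hj⟩ := h
    exact det_eq_zero_of_column_eq_zero j fun i => by simp [hj]

/-- `ν'` interlaces `ν` from above: `ν'_1 ≥ ν_1 ≥ ν'_2 ≥ ν_2 ≥ …`. -/
def InterlacesAbove {m : ℕ} (ν' ν : Fin m → ℕ) : Prop :=
  ∀ j, ν j ≤ ν' j ∧ ∀ r : Fin m, r.1 + 1 = j.1 → ν' j ≤ ν r

/-- Pieri's rule for the sum of all complete symmetric functions. Column j sums to a geometric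
series whose lower end is column j of a_ν and whose upper end is column j-1, so column operations
remove the upper ends. -/
theorem hasSum_alternant_interlacesAbove {m : ℕ} (x : Fin m → ℝ) (h0 : ∀ i, 0 ≤ x i)
    (h1 : ∀ i, x i < 1) (ν : Fin m → ℕ) (hν : Antitone ν) :
    HasSum (fun ν' : {ν' : Fin m → ℕ // InterlacesAbove ν' ν} => alternant x ν'.1)
      ((∏ i, (1 - x i)⁻¹) * alternant x ν) := by
  classical
  obtain _ | m := m
  · have : Unique {ν' : Fin 0 → ℕ // InterlacesAbove ν' ν} :=
      { default := ⟨fun _ => 0, fun j => j.elim0⟩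
        uniq := fun a => Subtype.ext (funext fun i => i.elim0) }
    simp [alternant]
  have hs : ∀ i j, HasSum (fun l => if ν j ≤ l ∧ ∀ r : Fin (m + 1), r.1 + 1 = j.1 → l ≤ ν r then
      x i ^ (l + (m + 1 - 1 - j.1)) else 0)
      ((1 - x i)⁻¹ * Fin.cases (motive := fun _ => ℝ) (x i ^ (ν 0 + m)) (fun j' =>
        x i ^ (ν j'.succ + (m - 1 - j'.1)) - x i ^ (ν j'.castSucc + (m - j'.1))) j) := by
    intro i j
    induction j using Fin.cases with
    | zero =>
      have h := hasSum_ite_le_pow (h0 i) (h1 i) (ν 0) m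
      rw [div_eq_inv_mul] at h
      simpa using h
    | succ j =>
      have h := hasSum_ite_le_le_pow (h0 i) (h1 i) (m - 1 - j.1)
        (hν (Fin.castSucc_lt_succ (i := j)).le)
      rw [div_eq_inv_mul] at h
      have hj := j.2
      have h2 : ∀ l, (∀ r : Fin (m + 1), r.1 + 1 = j.1 + 1 → l ≤ ν r) ↔ l ≤ ν j.castSucc := by
        intro l
        constructor
        · intro h; exact h _ rfl
        · intro h r hr
          have : r = j.castSucc := Fin.ext (by simpa using hr)
          rwa [this]
      simp only [Fin.cases_succ, Fin.val_succ, h2]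
      rw [show m + 1 - 1 - (j.1 + 1) = m - 1 - j.1 by omega]
      rwa [show m - 1 - j.1 + 1 = m - j.1 by omega] at h
  have h := hasSum_det _ _ hs
  simp only [det_ite_forall_eq_indicator x (fun j => m + 1 - 1 - j.1)
    (fun j l => ν j ≤ l ∧ ∀ r : Fin (m + 1), r.1 + 1 = j.1 → l ≤ ν r)] at h
  have h2 := (hasSum_subtype_iff_indicator (f := fun f : Fin (m + 1) → ℕ => alternant x f)
    (s := {f | InterlacesAbove f ν})).2 h
  refine Eq.subst (motive := HasSum _) ?_ h2
  have h3 := det_mul_column (fun i => (1 - x i)⁻¹) (of fun i j => Fin.cases (motive := fun _ => ℝ)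
    (x i ^ (ν 0 + m)) (fun j' : Fin m =>
        x i ^ (ν j'.succ + (m - 1 - j'.1)) - x i ^ (ν j'.castSucc + (m - j'.1))) j)
  simp only [of_apply] at h3
  rw [h3]
  congr 1
  symm
  refine det_eq_of_forall_col_eq_smul_add_pred (fun _ => 1) (fun i => by simp) fun i j => ?_
  simp only [of_apply, Fin.cases_succ, Fin.val_succ, Fin.val_castSucc]
  rw [show m + 1 - 1 - (j.1 + 1) = m - 1 - j.1 by omega, add_tsub_cancel_right]
  ring

/-- `ν'` interlaces `ν` from below: `ν_1 ≥ ν'_1 ≥ ν_2 ≥ … ≥ ν'_m ≥ ν_{m+1}`. -/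
def InterlacesBelow {m : ℕ} (ν' : Fin m → ℕ) (ν : Fin (m + 1) → ℕ) : Prop :=
  ∀ j, ν j.succ ≤ ν' j ∧ ν' j ≤ ν j.castSucc

/-- The branching rule. Column differences of the larger alternant turn the row of the variable 1
into (1, 0, …, 0), and the remaining minor is the matrix of geometric sums. -/
theorem hasSum_alternant_interlacesBelow {m : ℕ} (x : Fin m → ℝ) (h0 : ∀ i, 0 ≤ x i)
    (h1 : ∀ i, x i < 1) (ν : Fin (m + 1) → ℕ) (hν : Antitone ν) :
    HasSum (fun ν' : {ν' : Fin m → ℕ // InterlacesBelow ν' ν} => alternant x ν'.1)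
      ((∏ i, (1 - x i)⁻¹) * alternant (Fin.cons 1 x) ν) := by
  classical
  have hs : ∀ i j : Fin m, HasSum (fun l => if ν j.succ ≤ l ∧ l ≤ ν j.castSucc then
      x i ^ (l + (m - 1 - j.1)) else 0)
      ((1 - x i)⁻¹ * (x i ^ (ν j.succ + (m - 1 - j.1)) - x i ^ (ν j.castSucc + (m - j.1)))) := by
    intro i j
    have h := hasSum_ite_le_le_pow (h0 i) (h1 i) (m - 1 - j.1)
      (hν (Fin.castSucc_lt_succ (i := j)).le)
    have hj := j.2
    rwa [div_eq_inv_mul, show m - 1 - j.1 + 1 = m - j.1 by omega] at h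
  have h := hasSum_det _ _ hs
  simp only [det_ite_forall_eq_indicator x (fun j => m - 1 - j.1)
    (fun j l => ν j.succ ≤ l ∧ l ≤ ν j.castSucc)] at h
  have h2 := (hasSum_subtype_iff_indicator (f := fun f : Fin m → ℕ => alternant x f)
    (s := {f | InterlacesBelow f ν})).2 h
  refine Eq.subst (motive := HasSum _) ?_ h2
  have h3 := det_mul_column (fun i => (1 - x i)⁻¹) (of fun i j =>
    x i ^ (ν j.succ + (m - 1 - j.1)) - x i ^ (ν j.castSucc + (m - j.1)))
  simp only [of_apply] at h3
  rw [h3]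
  congr 1
  set B : Matrix (Fin (m + 1)) (Fin (m + 1)) ℝ := of fun i j => Fin.cases (motive := fun _ => ℝ)
    (Fin.cons (α := fun _ => ℝ) 1 x i ^ (ν 0 + m)) (fun j' : Fin m =>
      Fin.cons (α := fun _ => ℝ) 1 x i ^ (ν j'.succ + (m - 1 - j'.1)) -
        Fin.cons (α := fun _ => ℝ) 1 x i ^ (ν j'.castSucc + (m - j'.1))) j with hB
  have hAB : alternant (Fin.cons 1 x) ν = B.det := by
    refine det_eq_of_forall_col_eq_smul_add_pred (fun _ => 1) (fun i => by simp [hB]) fun i j => ?_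
    simp only [hB, of_apply, Fin.cases_succ, Fin.val_succ, Fin.val_castSucc]
    rw [show m + 1 - 1 - (j.1 + 1) = m - 1 - j.1 by omega, add_tsub_cancel_right]
    ring
  rw [hAB, det_succ_row_zero, Fin.sum_univ_succ]
  have h4 : B 0 0 = 1 := by simp [hB]
  have h5 : ∀ j : Fin m, B 0 j.succ = 0 := fun j => by simp [hB]
  simp only [h4, h5, mul_zero, zero_mul, sum_const_zero, add_zero]
  simp only [Fin.val_zero, pow_zero, one_mul, Fin.succAbove_zero]
  congr 1

theorem alternant_const_mul {m : ℕ} (q : ℝ) (x : Fin m → ℝ) (ν : Fin m → ℕ) :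
    alternant (fun i => q * x i) ν =
      q ^ (∑ j, ν j) * q ^ (∑ j : Fin m, (m - 1 - j.1)) * alternant x ν := by
  have h := det_mul_row (fun j : Fin m => q ^ (ν j + (m - 1 - j.1)))
    (of fun i j => x i ^ (ν j + (m - 1 - j.1)))
  rw [prod_pow_eq_pow_sum, sum_add_distrib, pow_add] at h
  rw [alternant, alternant, ← h]
  congr 1
  ext i j
  simp [mul_pow]

/-! ### Trapezoidal plane partitions and removal of the rightmost diagonal -/

/-- The diagram with `m` rows, row `i` (counted from `0`) consisting of the first `i + N` boxes. -/
def trapezoid (N m : ℕ) : Finset (ℕ × ℕ) :=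
  (range m ×ˢ range (m + N)).filter fun b => b.2 < b.1 + N

theorem mem_trapezoid {N m i j : ℕ} : (i, j) ∈ trapezoid N m ↔ i < m ∧ j < i + N := by
  simp only [trapezoid, mem_filter, mem_product, mem_range]
  omega

theorem volume_trapezoid {N m : ℕ} (T : PlanePartition (trapezoid N m)) :
    T.volume = ∑ i ∈ range m, ∑ j ∈ range (i + N), T.entry i j := by
  refine sum_finset_product (f := fun b : ℕ × ℕ => T.entry b.1 b.2) _ _ _ fun b => ?_
  rw [← Prod.mk.eta (p := b), mem_trapezoid]
  simp

/-- The rightmost diagonal of a plane partition of trapezoidal shape. -/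
def trapezoidDiagonal {N m : ℕ} (T : PlanePartition (trapezoid (N + 1) m)) : Fin m → ℕ :=
  fun r => T.entry r (r + N)

/-- The diagonal `ν` can be appended to `T`. -/
def Appendable {N m : ℕ} (T : PlanePartition (trapezoid N m)) (ν : Fin m → ℕ) : Prop :=
  -- Written as j + 1 = r + N, the first condition is void for r = N = 0, where the new box has no
  -- left neighbour.
  ∀ r : Fin m, (∀ j, j + 1 = r.1 + N → ν r ≤ T.entry r j) ∧
    (r.1 + 1 < m → T.entry (r + 1) (r + N) ≤ ν r)

/-- The plane partition obtained by removing the rightmost diagonal. -/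
def removeDiagonal {N m : ℕ} (T : PlanePartition (trapezoid (N + 1) m)) :
    PlanePartition (trapezoid N m) where
  entry i j := if j < i + N then T.entry i j else 0
  row_weak i j₁ j₂ hj h₁ h₂ := by
    rw [mem_trapezoid] at h₁ h₂
    rw [if_pos h₁.2, if_pos h₂.2]
    exact T.row_weak i j₁ j₂ hj (mem_trapezoid.2 (by omega)) (mem_trapezoid.2 (by omega))
  col_weak i₁ i₂ j hi h₁ h₂ := by
    rw [mem_trapezoid] at h₁ h₂
    rw [if_pos h₁.2, if_pos h₂.2]
    exact T.col_weak i₁ i₂ j hi (mem_trapezoid.2 (by omega)) (mem_trapezoid.2 (by omega))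
  zeros i j h := by
    rw [mem_trapezoid] at h
    split_ifs with hj
    · exact T.zeros i j (by rw [mem_trapezoid]; omega)
    · rfl

/-- The plane partition obtained by appending a diagonal. -/
def appendDiagonal {N m : ℕ} (T : PlanePartition (trapezoid N m)) (ν : Fin m → ℕ)
    (h : Appendable T ν) : PlanePartition (trapezoid (N + 1) m) where
  entry i j := if hij : i < m ∧ j = i + N then ν ⟨i, hij.1⟩ else T.entry i j
  row_weak i j₁ j₂ hj h₁ h₂ := by
    rw [mem_trapezoid] at h₁ h₂
    by_cases h3 : j₂ = i + N
    · rw [dif_pos ⟨h₁.1, h3⟩]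
      by_cases h4 : j₁ = i + N
      · rw [dif_pos ⟨h₁.1, h4⟩]
      · rw [dif_neg (by omega)]
        refine ((h ⟨i, h₁.1⟩).1 (j₂ - 1) (by dsimp only; omega)).trans ?_
        exact T.row_weak i _ _ (by omega) (mem_trapezoid.2 (by omega)) (mem_trapezoid.2 (by omega))
    · rw [dif_neg (by omega), dif_neg (by omega)]
      exact T.row_weak i _ _ hj (mem_trapezoid.2 (by omega)) (mem_trapezoid.2 (by omega))
  col_weak i₁ i₂ j hi h₁ h₂ := by
    rw [mem_trapezoid] at h₁ h₂
    rcases hi.eq_or_lt with rfl | hlt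
    · exact le_rfl
    rw [dif_neg (by omega)]
    by_cases h3 : j = i₁ + N
    · subst h3
      rw [dif_pos ⟨h₁.1, rfl⟩]
      refine le_trans ?_ ((h ⟨i₁, h₁.1⟩).2 (by dsimp only; omega))
      exact T.col_weak (i₁ + 1) i₂ (i₁ + N) (by omega) (mem_trapezoid.2 (by omega))
        (mem_trapezoid.2 (by omega))
    · rw [dif_neg (by omega)]
      exact T.col_weak _ _ _ hi (mem_trapezoid.2 (by omega)) (mem_trapezoid.2 (by omega))
  zeros i j hij := by
    rw [mem_trapezoid] at hij
    rw [dif_neg (by omega)]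
    exact T.zeros _ _ (by rw [mem_trapezoid]; omega)

theorem appendable_removeDiagonal {N m : ℕ} (T : PlanePartition (trapezoid (N + 1) m)) :
    Appendable (removeDiagonal T) (trapezoidDiagonal T) := by
  intro r
  have hr := r.2
  constructor
  · intro j hj
    simp only [removeDiagonal, trapezoidDiagonal]
    rw [if_pos (by omega)]
    exact T.row_weak _ _ _ (by omega) (mem_trapezoid.2 (by omega)) (mem_trapezoid.2 (by omega))
  · intro h
    simp only [removeDiagonal, trapezoidDiagonal]
    rw [if_pos (by omega)]
    exact T.col_weak _ _ _ (by omega) (mem_trapezoid.2 (by omega)) (mem_trapezoid.2 (by omega))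

/-- A plane partition with rightmost diagonal `ν` is a plane partition of the smaller shape to
which `ν` can be appended. -/
def removeDiagonalEquiv {N m : ℕ} (ν : Fin m → ℕ) :
    {T : PlanePartition (trapezoid (N + 1) m) // trapezoidDiagonal T = ν} ≃
      {T : PlanePartition (trapezoid N m) // Appendable T ν} where
  toFun T := ⟨removeDiagonal T.1, by
    have h := appendable_removeDiagonal T.1
    rwa [T.2] at h⟩
  invFun T := ⟨appendDiagonal T.1 ν T.2, by
    funext r
    exact dif_pos ⟨r.2, rfl⟩⟩
  left_inv T := by
    obtain ⟨T, rfl⟩ := T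
    refine Subtype.ext (PlanePartition.ext (funext fun i => funext fun j => ?_))
    simp only [appendDiagonal, removeDiagonal, trapezoidDiagonal]
    split_ifs with h1 h2
    · rw [h1.2]
    · rfl
    · exact (T.zeros _ _ (by rw [mem_trapezoid]; omega)).symm
  right_inv T := by
    refine Subtype.ext (PlanePartition.ext (funext fun i => funext fun j => ?_))
    simp only [appendDiagonal, removeDiagonal]
    split_ifs with h1 h2
    · omega
    · rfl
    · exact (T.1.zeros _ _ (by rw [mem_trapezoid]; omega)).symm

theorem volume_removeDiagonal {N m : ℕ} (T : PlanePartition (trapezoid (N + 1) m)) :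
    T.volume = (∑ r, trapezoidDiagonal T r) + (removeDiagonal T).volume := by
  rw [volume_trapezoid, volume_trapezoid,
    show ∑ r, trapezoidDiagonal T r = ∑ i ∈ range m, T.entry i (i + N) from
      (sum_range fun i => T.entry i (i + N)).symm, ← sum_add_distrib]
  refine sum_congr rfl fun i _ => ?_
  rw [← add_assoc, sum_range_succ, add_comm]
  congr 1
  refine sum_congr rfl fun j hj => ?_
  exact (if_pos (mem_range.1 hj)).symm

/-- Removal of the empty first row. -/
def removeEmptyRowEquiv (m : ℕ) :
    PlanePartition (trapezoid 0 (m + 1)) ≃ PlanePartition (trapezoid 1 m) where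
  toFun T :=
    { entry := fun i j => T.entry (i + 1) j
      row_weak := fun i j₁ j₂ hj h₁ h₂ => by
        rw [mem_trapezoid] at h₁ h₂
        exact T.row_weak _ _ _ hj (mem_trapezoid.2 (by omega)) (mem_trapezoid.2 (by omega))
      col_weak := fun i₁ i₂ j hi h₁ h₂ => by
        rw [mem_trapezoid] at h₁ h₂
        exact T.col_weak _ _ _ (by omega) (mem_trapezoid.2 (by omega)) (mem_trapezoid.2 (by omega))
      zeros := fun i j h => T.zeros _ _ (by rw [mem_trapezoid] at h ⊢; omega) }
  invFun T :=
    { entry := fun i j => if i = 0 then 0 else T.entry (i - 1) j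
      row_weak := fun i j₁ j₂ hj h₁ h₂ => by
        rw [mem_trapezoid] at h₁ h₂
        rw [if_neg (by omega), if_neg (by omega)]
        exact T.row_weak _ _ _ hj (mem_trapezoid.2 (by omega)) (mem_trapezoid.2 (by omega))
      col_weak := fun i₁ i₂ j hi h₁ h₂ => by
        rw [mem_trapezoid] at h₁ h₂
        rw [if_neg (by omega), if_neg (by omega)]
        exact T.col_weak _ _ _ (by omega) (mem_trapezoid.2 (by omega)) (mem_trapezoid.2 (by omega))
      zeros := fun i j h => by
        split_ifs with hi
        · rfl
        · exact T.zeros _ _ (by rw [mem_trapezoid] at h ⊢; omega) }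
  left_inv T := by
    refine PlanePartition.ext (funext fun i => funext fun j => ?_)
    dsimp only
    split_ifs with hi
    · exact (T.zeros _ _ (by rw [mem_trapezoid]; omega)).symm
    · rw [Nat.sub_add_cancel (by omega)]
  right_inv T := by
    refine PlanePartition.ext (funext fun i => funext fun j => ?_)
    simp

theorem volume_removeEmptyRowEquiv {m : ℕ} (T : PlanePartition (trapezoid 0 (m + 1))) :
    (removeEmptyRowEquiv m T).volume = T.volume := by
  rw [volume_trapezoid, volume_trapezoid, sum_range_succ']
  simp [removeEmptyRowEquiv]

theorem appendable_succ_iff {N m : ℕ} (T : PlanePartition (trapezoid (N + 1) m))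
    (ν : Fin m → ℕ) : Appendable T ν ↔ InterlacesAbove (trapezoidDiagonal T) ν := by
  constructor
  · intro h j
    refine ⟨(h j).1 _ (by omega), fun r hr => ?_⟩
    have := (h r).2 (by omega)
    rwa [hr, show r.1 + (N + 1) = j.1 + N by omega] at this
  · intro h r
    refine ⟨fun j hj => ?_, fun hr => ?_⟩
    · obtain rfl : j = r + N := by omega
      exact (h r).1
    · have := (h ⟨r + 1, hr⟩).2 r rfl
      simp only [trapezoidDiagonal] at this
      rwa [show r.1 + 1 + N = r.1 + (N + 1) by omega] at this

theorem appendable_zero_iff {m : ℕ} (T : PlanePartition (trapezoid 0 (m + 1)))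
    (ν : Fin (m + 1) → ℕ) :
    Appendable T ν ↔ InterlacesBelow (trapezoidDiagonal (N := 0) (removeEmptyRowEquiv m T)) ν := by
  constructor
  · intro h j
    exact ⟨(h j.succ).1 _ rfl, (h j.castSucc).2 (by simp)⟩
  · intro h r
    refine ⟨fun j hj => ?_, fun hr => ?_⟩
    · have hr := r.2
      have h1 := (h ⟨j, by omega⟩).1
      have h2 : (⟨j, by omega⟩ : Fin m).succ = r := Fin.ext (by simpa using hj)
      rw [h2] at h1
      rw [show r.1 = j + 1 by omega]
      exact h1
    · exact (h ⟨r, by omega⟩).2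

/-! ### Generating function by volume with prescribed rightmost diagonal -/

theorem HasSum.of_eq {α : Type*} {f : α → ℝ} {s t : ℝ} (h : HasSum f s) (hst : s = t) :
    HasSum f t := hst ▸ h

/-- Nonnegativity of the terms makes the whole family summable as soon as the fibre sums are. -/
theorem hasSum_of_fibers {α β : Type*} {f : α → ℝ} (hf : ∀ a, 0 ≤ f a) {d : α → β}
    {P : β → Prop} {g : β → ℝ} {s : ℝ}
    (h : ∀ b, P b → HasSum (fun a : {a // d a = b} => f a) (g b))
    (hs : HasSum (fun b : {b // P b} => g b) s) :
    HasSum (fun a : {a // P (d a)} => f a) s := by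
  let e : (Σ b : {b // P b}, {a // d a = b.1}) ≃ {a // P (d a)} :=
    { toFun := fun a => ⟨a.2.1, by rw [a.2.2]; exact a.1.2⟩
      invFun := fun a => ⟨⟨d a.1, a.2⟩, ⟨a.1, rfl⟩⟩
      left_inv := by
        rintro ⟨⟨b, hb⟩, ⟨a, ha⟩⟩
        change d a = b at ha
        subst ha
        rfl
      right_inv := fun a => rfl }
  rw [← e.hasSum_iff]
  refine HasSum.sigma_of_hasSum hs (fun b => h b.1 b.2) ?_
  refine (summable_sigma_of_nonneg fun _ => hf _).2 ⟨fun b => (h b.1 b.2).summable, ?_⟩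
  exact hs.summable.congr fun b => (h b.1 b.2).tsum_eq.symm

theorem InterlacesAbove.antitone {m : ℕ} {ν' ν : Fin m → ℕ} (h : InterlacesAbove ν' ν) :
    Antitone ν' := by
  obtain _ | m := m
  · exact fun i => i.elim0
  · refine Fin.antitone_iff_succ_le.2 fun i => ?_
    exact ((h i.succ).2 i.castSucc rfl).trans (h i.castSucc).1

theorem InterlacesBelow.antitone {m : ℕ} {ν' : Fin m → ℕ} {ν : Fin (m + 1) → ℕ}
    (h : InterlacesBelow ν' ν) : Antitone ν' := by
  obtain _ | m := m
  · exact fun i => i.elim0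
  · refine Fin.antitone_iff_succ_le.2 fun i => ?_
    exact (h i.succ).2.trans (h i.castSucc).1

/-- The inner diagonals are summed by Pieri's rule; the factor q^|ν| then passes from a_ν(x) to
a_ν(qx), up to a power of q independent of ν. -/
theorem hasSum_pow_volume_succ {N m : ℕ} {q C : ℝ} (hq0 : 0 < q) (hq1 : q < 1)
    (hC : ∀ ν : Fin m → ℕ, Antitone ν →
      HasSum (fun T : {T : PlanePartition (trapezoid (N + 1) m) // trapezoidDiagonal T = ν} =>
        q ^ T.1.volume) (C * alternant (fun i => q ^ (N + 1 + i.1)) ν))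
    (ν : Fin m → ℕ) (hν : Antitone ν) :
    HasSum (fun T : {T : PlanePartition (trapezoid (N + 1 + 1) m) // trapezoidDiagonal T = ν} =>
      q ^ T.1.volume) (C * (∏ i : Fin m, (1 - q ^ (N + 1 + i.1))⁻¹) *
        (q ^ (∑ j : Fin m, (m - 1 - j.1)))⁻¹ * alternant (fun i => q ^ (N + 1 + 1 + i.1)) ν) := by
  set x : Fin m → ℝ := fun i => q ^ (N + 1 + i.1) with hx
  have h1 := (hasSum_alternant_interlacesAbove x
    (fun i => by positivity) (fun i => pow_lt_one₀ hq0.le hq1 (by omega)) ν hν).mul_left C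
  have h2 : HasSum (fun T : {T : PlanePartition (trapezoid (N + 1) m) //
      InterlacesAbove (trapezoidDiagonal T) ν} => q ^ T.1.volume) _ :=
    hasSum_of_fibers (f := fun T : PlanePartition (trapezoid (N + 1) m) => q ^ T.volume)
      (d := trapezoidDiagonal) (P := fun ν' => InterlacesAbove ν' ν)
      (g := fun ν' => C * alternant x ν') (fun T => pow_nonneg hq0.le _)
      (fun ν' hν' => hC ν' (InterlacesAbove.antitone hν')) h1
  replace h2 := h2.mul_left (q ^ ∑ j, ν j)
  let e := (removeDiagonalEquiv (N := N + 1) ν).trans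
    (Equiv.subtypeEquivRight fun T => appendable_succ_iff T ν)
  rw [← e.hasSum_iff] at h2
  have h3 := alternant_const_mul q x ν
  have h4 : (fun i : Fin m => q * x i) = fun i => q ^ (N + 1 + 1 + i.1) := by
    funext i; simp only [hx]; ring
  rw [h4] at h3
  have h5 : q ^ (∑ j : Fin m, (m - 1 - j.1)) ≠ 0 := by positivity
  refine HasSum.of_eq (h2.congr_fun ?_) ?_
  rotate_left
  · rw [h3]
    generalize q ^ (∑ j : Fin m, (m - 1 - j.1)) = D at h5
    linear_combination (-C * (∏ i, (1 - x i)⁻¹) * q ^ (∑ j, ν j) * alternant x ν) *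
      inv_mul_cancel₀ h5
  · rintro ⟨T, rfl⟩
    rw [Function.comp_apply, volume_removeDiagonal, pow_add]
    rfl

/-- Here the inner diagonal is shorter by one, so the branching rule applies: q, …, q^m is extended
by 1 and multiplied by q to give q, …, q^(m+1). -/
theorem hasSum_pow_volume_trapezoid_one {m : ℕ} {q C : ℝ} (hq0 : 0 < q) (hq1 : q < 1)
    (hC : ∀ ν : Fin m → ℕ, Antitone ν →
      HasSum (fun T : {T : PlanePartition (trapezoid (0 + 1) m) // trapezoidDiagonal T = ν} =>
        q ^ T.1.volume) (C * alternant (fun i => q ^ (0 + 1 + i.1)) ν))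
    (ν : Fin (m + 1) → ℕ) (hν : Antitone ν) :
    HasSum (fun T : {T : PlanePartition (trapezoid (0 + 1) (m + 1)) // trapezoidDiagonal T = ν} =>
      q ^ T.1.volume) (C * (∏ i : Fin m, (1 - q ^ (0 + 1 + i.1))⁻¹) *
        (q ^ (∑ j : Fin (m + 1), (m + 1 - 1 - j.1)))⁻¹ *
          alternant (fun i => q ^ (0 + 1 + i.1)) ν) := by
  set x : Fin m → ℝ := fun i => q ^ (0 + 1 + i.1) with hx
  have h1 := (hasSum_alternant_interlacesBelow x
    (fun i => by positivity) (fun i => pow_lt_one₀ hq0.le hq1 (by omega)) ν hν).mul_left C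
  have h2 : HasSum (fun T : {T : PlanePartition (trapezoid (0 + 1) m) //
      InterlacesBelow (trapezoidDiagonal T) ν} => q ^ T.1.volume) _ :=
    hasSum_of_fibers (f := fun T : PlanePartition (trapezoid (0 + 1) m) => q ^ T.volume)
      (d := trapezoidDiagonal) (P := fun ν' => InterlacesBelow ν' ν)
      (g := fun ν' => C * alternant x ν') (fun T => pow_nonneg hq0.le _)
      (fun ν' hν' => hC ν' (InterlacesBelow.antitone hν')) h1
  replace h2 := h2.mul_left (q ^ ∑ j, ν j)
  let e : {T : PlanePartition (trapezoid (0 + 1) (m + 1)) // trapezoidDiagonal T = ν} ≃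
      {T : PlanePartition (trapezoid (0 + 1) m) // InterlacesBelow (trapezoidDiagonal T) ν} :=
    (removeDiagonalEquiv (N := 0) ν).trans ((removeEmptyRowEquiv m).subtypeEquiv fun T => appendable_zero_iff T ν)
  rw [← e.hasSum_iff] at h2
  have h3 := alternant_const_mul q (Fin.cons 1 x) ν
  have h4 : (fun i => q * (Fin.cons 1 x : Fin (m + 1) → ℝ) i) = fun i => q ^ (0 + 1 + i.1) := by
    funext i
    induction i using Fin.cases with
    | zero => simp
    | succ i => simp only [Fin.cons_succ, Fin.val_succ, hx]; ring
  rw [h4] at h3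
  have h5 : q ^ (∑ j : Fin (m + 1), (m + 1 - 1 - j.1)) ≠ 0 := by positivity
  refine HasSum.of_eq (h2.congr_fun ?_) ?_
  rotate_left
  · rw [h3]
    generalize q ^ (∑ j : Fin (m + 1), (m + 1 - 1 - j.1)) = D at h5
    linear_combination (-C * (∏ i, (1 - x i)⁻¹) * q ^ (∑ j, ν j) * alternant (Fin.cons 1 x) ν) *
      inv_mul_cancel₀ h5
  · rintro ⟨T, rfl⟩
    rw [Function.comp_apply, volume_removeDiagonal, pow_add]
    congr 2
    exact (volume_removeEmptyRowEquiv _).symm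

theorem exists_hasSum_pow_volume {q : ℝ} (hq0 : 0 < q) (hq1 : q < 1) (N m : ℕ) :
    ∃ C : ℝ, ∀ ν : Fin m → ℕ, Antitone ν →
      HasSum (fun T : {T : PlanePartition (trapezoid (N + 1) m) // trapezoidDiagonal T = ν} =>
        q ^ T.1.volume) (C * alternant (fun i => q ^ (N + 1 + i.1)) ν) := by
  induction N with
  | zero =>
    induction m with
    | zero =>
      refine ⟨1, fun ν _ => ?_⟩
      have hmem : ∀ i j, (i, j) ∉ trapezoid (0 + 1) 0 := fun i j => by simp [mem_trapezoid]
      have : Unique {T : PlanePartition (trapezoid (0 + 1) 0) // trapezoidDiagonal T = ν} :=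
        { default := ⟨⟨fun _ _ => 0, fun _ _ _ _ _ _ => le_rfl, fun _ _ _ _ _ _ => le_rfl,
            fun _ _ _ => rfl⟩, funext fun i => i.elim0⟩
          uniq := fun T => Subtype.ext (PlanePartition.ext (funext fun i => funext fun j =>
            T.1.zeros i j (hmem i j))) }
      have h := hasSum_unique fun T : {T : PlanePartition (trapezoid (0 + 1) 0) //
        trapezoidDiagonal T = ν} => q ^ T.1.volume
      simp [alternant, volume_trapezoid]
    | succ m ih =>
      obtain ⟨C, hC⟩ := ih
      exact ⟨_, fun ν hν => hasSum_pow_volume_trapezoid_one hq0 hq1 hC ν hν⟩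
  | succ N ih =>
    obtain ⟨C, hC⟩ := ih
    exact ⟨_, fun ν hν => hasSum_pow_volume_succ hq0 hq1 hC ν hν⟩

/-! ### From truncated rectangles to trapezoids -/

theorem mem_truncatedRectangle {n m k i j : ℕ} :
    (i, j) ∈ truncatedRectangle n m k ↔ i < m ∧ j < n ∧ j < n - (k - i) := by
  simp only [truncatedRectangle, mem_filter, mem_product, mem_range]
  tauto

theorem PlanePartition.entry_eq_of_hasRightmostDiagonal {n m k : ℕ} (hkn : k < n)
    {T : PlanePartition (truncatedRectangle n m k)} {μ : ℕ → ℕ} (hT : T.HasRightmostDiagonal μ)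
    (hμ0 : ∀ i, k < i → μ i = 0) (r : ℕ) : T.entry r (r + (n - k - 1)) = μ r := by
  by_cases hr : r ≤ k
  · rw [add_comm]
    exact hT r hr
  · rw [hμ0 r (by omega)]
    exact T.zeros _ _ (by rw [mem_truncatedRectangle]; omega)

/-- A plane partition of truncated rectangular shape with rightmost diagonal `μ` is a plane
partition of trapezoidal shape whose rightmost diagonal is `μ`, padded with zeros. -/
def truncatedRectangleEquiv {n m k : ℕ} (hkn : k < n) (hkm : k < m) {μ : ℕ → ℕ}
    (hμ0 : ∀ i, k < i → μ i = 0) :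
    {T : PlanePartition (truncatedRectangle n m k) // T.HasRightmostDiagonal μ} ≃
      {T : PlanePartition (trapezoid (n - k - 1 + 1) m) //
        trapezoidDiagonal T = fun r : Fin m => μ r} where
  toFun T := ⟨{
    entry := T.1.entry
    row_weak := fun i j₁ j₂ hj h₁ h₂ => by
      rw [mem_trapezoid] at h₁ h₂
      by_cases h : j₂ < n
      · exact T.1.row_weak _ _ _ hj (mem_truncatedRectangle.2 (by omega))
          (mem_truncatedRectangle.2 (by omega))
      · rw [T.1.zeros i j₂ (by rw [mem_truncatedRectangle]; omega)]
        exact Nat.zero_le _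
    col_weak := fun i₁ i₂ j hi h₁ h₂ => by
      rw [mem_trapezoid] at h₁ h₂
      by_cases h : j < n
      · exact T.1.col_weak _ _ _ hi (mem_truncatedRectangle.2 (by omega))
          (mem_truncatedRectangle.2 (by omega))
      · rw [T.1.zeros i₂ j (by rw [mem_truncatedRectangle]; omega)]
        exact Nat.zero_le _
    zeros := fun i j h => T.1.zeros _ _ (by
      rw [mem_trapezoid] at h
      rw [mem_truncatedRectangle]
      omega) }, funext fun r => T.1.entry_eq_of_hasRightmostDiagonal hkn T.2 hμ0 r⟩
  invFun T := ⟨{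
    entry := T.1.entry
    row_weak := fun i j₁ j₂ hj h₁ h₂ => by
      rw [mem_truncatedRectangle] at h₁ h₂
      exact T.1.row_weak _ _ _ hj (mem_trapezoid.2 (by omega)) (mem_trapezoid.2 (by omega))
    col_weak := fun i₁ i₂ j hi h₁ h₂ => by
      rw [mem_truncatedRectangle] at h₁ h₂
      exact T.1.col_weak _ _ _ hi (mem_trapezoid.2 (by omega)) (mem_trapezoid.2 (by omega))
    zeros := fun i j h => by
      by_cases h1 : (i, j) ∈ trapezoid (n - k - 1 + 1) m
      · rw [mem_trapezoid] at h1
        rw [mem_truncatedRectangle] at h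
        -- Here j ≥ n, and the top box of column j of the trapezoid lies on the rightmost diagonal
        -- in a row below row k, where μ vanishes; so the column is zero.
        have h2 := T.1.col_weak (j - (n - k - 1)) i j (by omega) (mem_trapezoid.2 (by omega))
          (mem_trapezoid.2 (by omega))
        have h3 := congrFun T.2 ⟨j - (n - k - 1), by omega⟩
        simp only [trapezoidDiagonal] at h3
        rw [show j - (n - k - 1) + (n - k - 1) = j by omega, hμ0 _ (by omega)] at h3
        omega
      · exact T.1.zeros _ _ h1 }, fun r hr => by
    have h3 := congrFun T.2 ⟨r, by omega⟩
    simp only [trapezoidDiagonal] at h3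
    rw [add_comm r] at h3
    exact h3⟩
  left_inv T := rfl
  right_inv T := rfl

theorem volume_truncatedRectangleEquiv {n m k : ℕ} (hkn : k < n) (hkm : k < m) {μ : ℕ → ℕ}
    (hμ0 : ∀ i, k < i → μ i = 0)
    (T : {T : PlanePartition (truncatedRectangle n m k) // T.HasRightmostDiagonal μ}) :
    (truncatedRectangleEquiv hkn hkm hμ0 T).1.volume = T.1.volume := by
  refine (sum_subset (fun b hb => ?_) fun b _ hb => T.1.zeros _ _ hb).symm
  rw [← Prod.mk.eta (p := b), mem_truncatedRectangle] at hb
  rw [← Prod.mk.eta (p := b), mem_trapezoid]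
  omega

/-- The rightmost diagonal, as a partition. -/
def PlanePartition.rightmostDiagonal {n m k : ℕ} (hkn : k < n) (hkm : k < m)
    (T : PlanePartition (truncatedRectangle n m k)) : BoundedPartition (k + 1) :=
  ⟨fun r => if r ≤ k then T.entry r (n - k - 1 + r) else 0, by
    refine antitone_nat_of_succ_le fun r => ?_
    split_ifs with h1 h2
    · refine (T.row_weak (r + 1) (n - k - 1 + r) (n - k - 1 + (r + 1)) (by omega)
        (mem_truncatedRectangle.2 (by omega)) (mem_truncatedRectangle.2 (by omega))).trans ?_
      exact T.col_weak _ _ _ (by omega)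
        (mem_truncatedRectangle.2 (by omega)) (mem_truncatedRectangle.2 (by omega))
    · omega
    · exact Nat.zero_le _
    · exact le_rfl, fun i hi => if_neg (by omega)⟩

theorem PlanePartition.hasRightmostDiagonal_iff {n m k : ℕ} (hkn : k < n) (hkm : k < m)
    (T : PlanePartition (truncatedRectangle n m k)) (μ : BoundedPartition (k + 1)) :
    T.HasRightmostDiagonal μ.1 ↔ T.rightmostDiagonal hkn hkm = μ := by
  constructor
  · intro h
    refine Subtype.ext (funext fun r => ?_)
    simp only [rightmostDiagonal]
    split_ifs with hr
    · exact h r hr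
    · exact (μ.2.2 r (by omega)).symm
  · rintro rfl r hr
    exact (if_pos hr).symm

theorem exists_hasSum_pow_volume_truncatedRectangle {n m k : ℕ} (hkn : k < n) (hkm : k < m)
    {q : ℝ} (hq0 : 0 < q) (hq1 : q < 1) :
    ∃ C : ℝ, ∀ μ : BoundedPartition (k + 1),
      HasSum (fun T : {T : PlanePartition (truncatedRectangle n m k) //
        T.HasRightmostDiagonal μ.1} => q ^ T.1.volume)
        (C * alternant (fun i : Fin m => q ^ (n - k + i.1)) fun j => μ.1 j) := by
  obtain ⟨C, hC⟩ := exists_hasSum_pow_volume hq0 hq1 (n - k - 1) m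
  refine ⟨C, fun μ => ?_⟩
  have h := hC (fun j => μ.1 j) fun i j hij => μ.2.1 hij
  have hμ0 : ∀ i, k < i → μ.1 i = 0 := fun i hi => μ.2.2 i hi
  rw [← (truncatedRectangleEquiv hkn hkm hμ0).hasSum_iff] at h
  refine HasSum.of_eq (h.congr_fun fun T => ?_) ?_
  · rw [Function.comp_apply, volume_truncatedRectangleEquiv]
  · simp only [show n - k - 1 + 1 = n - k by omega]

/-! ### Product form of the numerator, and the conclusion -/

/-- The alternant at `x_i = q^(N+i)` is a Vandermonde determinant. -/
theorem alternant_pow {m : ℕ} (q : ℝ) (N : ℕ) (ν : Fin m → ℕ) :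
    alternant (fun i => q ^ (N + i.1)) ν = (∏ j : Fin m, q ^ (N * (ν j + (m - 1 - j.1)))) *
      ∏ i : Fin m, ∏ j ∈ Ioi i, (q ^ (ν j + (m - 1 - j.1)) - q ^ (ν i + (m - 1 - i.1))) := by
  rw [← det_vandermonde fun j => q ^ (ν j + (m - 1 - j.1)), ← det_mul_column, alternant,
    ← det_transpose]
  congr 1
  ext j i
  simp only [transpose_apply, of_apply, vandermonde_apply, ← pow_mul, ← pow_add]
  congr 1
  ring

theorem prod_range_prod_range_eq_prod_fin_ite (m : ℕ) (f : ℕ → ℕ → ℝ) :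
    ∏ j ∈ range m, ∏ i ∈ range j, f i j =
      ∏ j : Fin m, ∏ i : Fin m, if i < j then f i j else 1 := by
  rw [prod_range]
  refine prod_congr rfl fun j _ => ?_
  have h := prod_range (fun i => if i < j.1 then f i j else 1) (n := m)
  simp only [Fin.lt_def]
  rw [← h, ← prod_filter]
  refine prod_congr ?_ fun _ _ => rfl
  ext i
  have := j.2
  simp only [mem_range, mem_filter]
  omega

theorem prod_range_prod_range_eq_prod_Ioi (m : ℕ) (f : ℕ → ℕ → ℝ) :
    ∏ j ∈ range m, ∏ i ∈ range j, f i j = ∏ i : Fin m, ∏ j ∈ Ioi i, f i j := by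
  rw [prod_range_prod_range_eq_prod_fin_ite, prod_comm]
  refine prod_congr rfl fun i _ => ?_
  rw [← prod_filter]
  refine prod_congr ?_ fun _ _ => rfl
  ext j
  simp

theorem alternant_mul_littlewoodProd (m k N : ℕ) (hkm : k < m) (q : ℝ) (μ : ℕ → ℕ)
    (hμ0 : ∀ i, k < i → μ i = 0) :
    (alternant (fun i : Fin m => q ^ (N + i.1)) fun j => μ j) *
        littlewoodProd (fun i : Fin m => q ^ (N + i.1)) =
      q ^ ((∑ i ∈ range (k + 1), μ i) * N) * (∏ i ∈ range m, (1 - q ^ (N + i))) *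
        ∏ j ∈ range m, ∏ i ∈ range j,
          q ^ N * (q ^ (μ j + (m - 1 - j)) - q ^ (μ i + (m - 1 - i))) *
            (1 - q ^ (2 * N + i + j)) := by
  rw [alternant_pow, littlewoodProd]
  have h1 := prod_range_prod_range_eq_prod_Ioi m fun i j =>
    q ^ (μ j + (m - 1 - j)) - q ^ (μ i + (m - 1 - i))
  have h2 := prod_range_prod_range_eq_prod_fin_ite m fun i j => 1 - q ^ (N + i) * q ^ (N + j)
  have h3 := prod_range (fun i => 1 - q ^ (N + i)) (n := m)
  have h4 := prod_range (fun j => q ^ (N * (μ j + (m - 1 - j)))) (n := m)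
  rw [← h1, ← h2, ← h3, ← h4]
  -- The factors q^(N(m-1-j)) of the alternant amount to one q^N for each pair i < j.
  have h5 : ∏ j ∈ range m, ∏ _i ∈ range j, q ^ N = ∏ j ∈ range m, q ^ (N * (m - 1 - j)) := by
    rw [prod_range_reflect fun j => q ^ (N * j)]
    simp [pow_mul]
  have h6 : ∑ i ∈ range (k + 1), μ i = ∑ i ∈ range m, μ i := by
    refine sum_subset (range_subset_range.2 hkm) fun i _ hi => hμ0 i ?_
    simpa using hi
  have h7 : ∏ j ∈ range m, ∏ i ∈ range j, (1 - q ^ (N + i) * q ^ (N + j)) =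
      ∏ j ∈ range m, ∏ i ∈ range j, (1 - q ^ (2 * N + i + j)) := by
    refine prod_congr rfl fun j _ => prod_congr rfl fun i _ => ?_
    rw [← pow_add]
    congr 2
    ring
  simp only [prod_mul_distrib]
  rw [h5, h6, h7]
  simp only [mul_add, pow_add, prod_mul_distrib]
  rw [prod_pow_eq_pow_sum, ← mul_sum, mul_comm N]
  ring

theorem mainTheorem12 (n m k : ℕ) (hkn : k < n) (hkm : k < m) (q : ℝ) (hq0 : 0 < q) (hq1 : q < 1)
    (μ : ℕ → ℕ) (hμ : Antitone μ) (hμ0 : ∀ i, k < i → μ i = 0) :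
    Summable (fun T : PlanePartition (truncatedRectangle n m k) => q ^ T.volume) ∧
    (kingMatrix n m k q).det ≠ 0 ∧
    diagonalDistribution n m k q μ =
      (q ^ ((∑ i ∈ Finset.range (k + 1), μ i) * (n - k)) *
        (∏ i ∈ Finset.range m, (1 - q ^ (n - k + i))) *
        ∏ j ∈ Finset.range m, ∏ i ∈ Finset.range j,
          q ^ (n - k) * (q ^ (μ j + (m - 1 - j)) - q ^ (μ i + (m - 1 - i))) *
            (1 - q ^ (2 * (n - k) + i + j))) /
      (kingMatrix n m k q).det := by
  obtain ⟨C, hC⟩ := exists_hasSum_pow_volume_truncatedRectangle hkn hkm hq0 hq1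
  set x : Fin m → ℝ := fun i => q ^ (n - k + i.1) with hx
  have hxlt : ∀ i, x i < 1 := fun i => pow_lt_one₀ hq0.le hq1 (by omega)
  obtain ⟨F, hF, hFK⟩ := exists_hasSum_alternant m (k + 1) hkm x (fun i => by positivity) hxlt
  have hK : kingMat m (k + 1) x = kingMatrix n m k q := by
    ext i j
    simp only [kingMat, kingMatrix, of_apply, hx, ← pow_mul, Nat.succ_le_iff]
    rw [show m - (k + 1) = m - k - 1 by omega]
  have hP : littlewoodProd x ≠ 0 := by
    refine mul_ne_zero (prod_ne_zero_iff.2 fun i _ => by linarith [hxlt i])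
      (prod_ne_zero_iff.2 fun j _ => prod_ne_zero_iff.2 fun i _ => ?_)
    split_ifs
    · have h0 : 0 < x i := by positivity
      nlinarith [hxlt i, hxlt j]
    · exact one_ne_zero
  have htot : HasSum (fun T : {T : PlanePartition (truncatedRectangle n m k) // True} =>
      q ^ T.1.volume) (C * F) := by
    refine hasSum_of_fibers (f := fun T : PlanePartition (truncatedRectangle n m k) => q ^ T.volume)
      (d := PlanePartition.rightmostDiagonal hkn hkm) (P := fun _ => True)
      (g := fun ν => C * alternant x fun j => ν.1 j) (fun T => pow_nonneg hq0.le _)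
      (fun ν _ => ?_) ?_
    · have h := hC ν
      rw [← (Equiv.subtypeEquivRight fun T =>
        (PlanePartition.hasRightmostDiagonal_iff hkn hkm T ν).symm).hasSum_iff] at h
      exact h
    · rw [← (Equiv.subtypeUnivEquiv fun _ => trivial).symm.hasSum_iff]
      exact hF.mul_left C
  rw [← (Equiv.subtypeUnivEquiv fun _ => trivial).symm.hasSum_iff] at htot
  replace htot : HasSum (fun T : PlanePartition (truncatedRectangle n m k) => q ^ T.volume)
    (C * F) := htot
  -- The total is positive, the zero plane partition having positive weight; hence C and F are
  -- nonzero, and with F the determinant.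
  have hpos : 0 < C * F := by
    rw [← htot.tsum_eq]
    exact htot.summable.tsum_pos (fun T => pow_nonneg hq0.le _)
      ⟨fun _ _ => 0, fun _ _ _ _ _ _ => le_rfl, fun _ _ _ _ _ _ => le_rfl, fun _ _ _ => rfl⟩
      (pow_pos hq0 _)
  have hC0 : C ≠ 0 := left_ne_zero_of_mul hpos.ne'
  have hF0 : F ≠ 0 := right_ne_zero_of_mul hpos.ne'
  rw [← hK, ← hFK]
  refine ⟨htot.summable, mul_ne_zero hF0 hP, ?_⟩
  rw [diagonalDistribution, htot.tsum_eq,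
    (hC ⟨μ, hμ, fun i hi => hμ0 i hi⟩).tsum_eq, ← alternant_mul_littlewoodProd m k (n - k) hkm q μ hμ0]
  rw [mul_div_mul_left _ _ hC0, mul_div_mul_right _ _ hP]
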